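/- Let $n\ge 1$ be an integer and write $\mathbf a\mathbf x=\sum_i a_ix_i$. A branching proof (of integer infeasibility) for a convex set $K\subseteq\mathbb R^n$ is a finite rooted binary tree $\mathcal T$ in which every internal node $v$ is labeled by a pair $(\mathbf a_v,b_v)\in\mathbb Z^n\times\mathbb Z$ and has exactly two children, such that the following holds: the edge from $v$ to its left child is labeled by the inequality $\mathbf a_v\mathbf x\le b_v$, the edge to its right child by $-\mathbf a_v\mathbf x\le -b_v-1$ (that is, $\mathbf a_v\mathbf x\ge b_v+1$), and for every leaf, no point of $K$ satisfies all the inequalities on the path from the root to that leaf. Its length $|\mathcal T|$ is the number of its nodes, leaves included. Its bit-size $\langle\mathcal T\rangle$ is the number of nodes plus the number of edges plus the sum of the bit-sizes of all labels of edges and of internal nodes, where the bit-size of a label $(\mathbf a,b)$ (an edge inequality $\mathbf a\mathbf x\le b$ counting as the label $(\mathbf a,b)$) is $n+\sum_{i=1}^n\langle a_i\rangle+\langle b\rangle$, with $\langle p\rangle=2+\lceil\log_2(|p|+1)\rceil$ for $p\in\mathbb Z$. There is an absolute constant $C>0$ such that the following holds for all integers $n\ge 1$ and $R\ge 1$. Let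 $K\subseteq\mathbb R^n$ be a compact convex set with $K\cap\mathbb Z^n=\emptyset$ and $K\subseteq\{\mathbf x\in\mathbb R^n:\|\mathbf x\|_1\le R\}$, and let $\mathcal T$ be a branching proof for $K$. Then there is a branching proof $\mathcal T'$ for $K$ such that 1. $|\mathcal T'|\le C\,n\,|\mathcal T|$; 2. every edge of $\mathcal T'$ is labeled by an inequality $\mathbf a'\mathbf x\le b'$ with $\mathbf a'\in\mathbb Z^n$, $b'\in\mathbb Z$ and $\max\{\|\mathbf a'\|_\infty,|b'|\}\le(10nR)^{(n+2)^2}$; 3. $\langle\mathcal T'\rangle\le C\,n^3\log_2(2nR)\,|\mathcal T|$. -/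

import Mathlib

/-- A linear inequality `a x ≤ b` in `n` variables with integer data. -/
structure IntIneq (n : ℕ) where
  a : Fin n → ℤ
  b : ℤ

/-- The halfspace `{x ∈ ℝⁿ : a x ≤ b}`. -/
def IntIneq.halfspace {n : ℕ} (e : IntIneq n) : Set (Fin n → ℝ) :=
  {x | ∑ i, (e.a i : ℝ) * x i ≤ (e.b : ℝ)}

/-- The other side `-a x ≤ -b - 1`, i.e. `a x ≥ b + 1`, of the integer disjunction given by
`(a, b)`. -/
def IntIneq.flip {n : ℕ} (e : IntIneq n) : IntIneq n :=
  ⟨fun i => -e.a i, -e.b - 1⟩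

/-- The bit-size `1 + ⌈log₂ (|p| + 1)⌉ + ⌈log₂ (q + 1)⌉` of a rational number `p / q` in lowest
terms with `q > 0` (`Nat.clog 2 m` is `⌈log₂ m⌉` for `m ≥ 1`). -/
def ratBitSize (r : ℚ) : ℕ :=
  1 + Nat.clog 2 (r.num.natAbs + 1) + Nat.clog 2 (r.den + 1)

/-- The bit-size of a rational vector: its dimension plus the bit-sizes of its entries. -/
def vecBitSize {n : ℕ} (c : Fin n → ℚ) : ℕ :=
  n + ∑ i, ratBitSize (c i)

/-- The bit-size of the pair `(a, b)`. -/
def IntIneq.bitSize {n : ℕ} (e : IntIneq n) : ℕ :=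
  vecBitSize (fun i => (e.a i : ℚ)) + ratBitSize (e.b : ℚ)

/-- A rooted binary tree whose internal nodes `v` are labeled by `(a_v, b_v) ∈ ℤⁿ × ℤ` and have a
left and a right child. The left edge at `v` carries the inequality `a_v x ≤ b_v`, the right edge
the inequality `-a_v x ≤ -b_v - 1`. -/
inductive BranchTree (n : ℕ) : Type where
  | leaf : BranchTree n
  | node (e : IntIneq n) (l r : BranchTree n) : BranchTree n

namespace BranchTree

variable {n : ℕ}

/-- The length `|T|`: the number of nodes, leaves included. -/
def length : BranchTree n → ℕ
  | leaf => 1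
  | node _ l r => 1 + l.length + r.length

/-- The labels of the internal nodes. -/
def nodeLabels : BranchTree n → List (IntIneq n)
  | leaf => []
  | node e l r => e :: (l.nodeLabels ++ r.nodeLabels)

/-- The labels of the edges, one entry for each edge. -/
def edgeLabels : BranchTree n → List (IntIneq n)
  | leaf => []
  | node e l r => e :: e.flip :: (l.edgeLabels ++ r.edgeLabels)

/-- For each leaf, the list of the edge labels on the path from the root to that leaf. -/
def leafPaths : BranchTree n → List (List (IntIneq n))
  | leaf => [[]]
  | node e l r => l.leafPaths.map (e :: ·) ++ r.leafPaths.map (e.flip :: ·)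

/-- The bit-size of `T` as a labeled rooted tree: the number of nodes, plus the number of edges,
plus the bit-sizes of all edge labels and of all node labels. -/
def bitSize (T : BranchTree n) : ℕ :=
  T.length + T.edgeLabels.length + (T.edgeLabels.map IntIneq.bitSize).sum
    + (T.nodeLabels.map IntIneq.bitSize).sum

/-- `T` is a branching proof of integer infeasibility for `K`: at every leaf `v`, the relaxation
`K_v`, consisting of the points of `K` that satisfy all inequalities on the path from the root to
`v`, is empty. -/
def IsBranchingProof (T : BranchTree n) (K : Set (Fin n → ℝ)) : Prop :=
  ∀ p ∈ T.leafPaths, K ∩ {x | ∀ e ∈ p, x ∈ e.halfspace} = ∅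

end BranchTree

/-- `K` contains no point of `ℤⁿ`. -/
def IntegerFree {n : ℕ} (K : Set (Fin n → ℝ)) : Prop :=
  ∀ z : Fin n → ℤ, (fun i => (z i : ℝ)) ∉ K

/-! Rounding a label to small coefficients moves its halfspace, so infeasibility at a leaf may be
lost. The rounding is chosen so that O(n) extra nodes below each leaf repair the loss.

A label, read as an integer form f in the coordinates (x, -1), is replaced by M₁h₁ + (M₂h₂ + ...):
h₁ is a Dirichlet approximation of a multiple t₁f, h₂ does the same for f on h₁ = 0, and so on,
until the remainder equals f wherever all layers vanish (`exists_lexApprox`).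

At a leaf, Helly keeps at most n + 1 of the original inequalities and Farkas gives weights w making
their combination positive on K. Take the current first layer h with the largest w/t. At a point
obeying the rounded inequalities with |h| ≥ 1, the slack of this one inequality outweighs all
possible violations of the others, so the combination would be nonpositive. Hence |h| < 1, and two
branchings leave only h = 0, where the next layer takes over. Each such h is independent of the
earlier ones, so this happens at most n + 1 times; at the end rounded and original forms agree and
Farkas gives a contradiction (`exists_closing_tree`). `exists_rounded_tree` puts these trees below
the rounded copy of the given tree. -/

/-- Dirichlet's theorem on simultaneous Diophantine approximation. -/
theorem exists_simultaneous_approx {ι : Type*} (S : Finset ι) (α : ι → ℝ) (Q : ℕ) (hQ : 0 < Q) :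
    ∃ (q : ℕ) (p : ι → ℤ), 0 < q ∧ q ≤ Q ^ S.card ∧ ∀ i ∈ S, |q * α i - p i| ≤ 1 / Q := by
  classical
  have hQ' : (0 : ℝ) < Q := by exact_mod_cast hQ
  -- Pigeonhole: `F k` is the box of side 1/Q containing the fractional parts of k α, with Q ^ |S|
  -- boxes for Q ^ |S| + 1 values of k.
  let F : ℕ → (S → Fin Q) := fun k i =>
    ⟨⌊Int.fract (k * α i) * Q⌋₊, by
      rw [Nat.floor_lt (by positivity)]
      nlinarith [Int.fract_lt_one ((k : ℝ) * α i)]⟩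
  have hcard : (Finset.univ : Finset (S → Fin Q)).card < (Finset.range (Q ^ S.card + 1)).card := by
    simp
  obtain ⟨k, hk, l, hl, hkl, hF⟩ := Finset.exists_ne_map_eq_of_card_lt_of_maps_to hcard
    (f := F) (fun _ _ => Finset.mem_univ _)
  have key : ∀ k l : ℕ, k < l → l ≤ Q ^ S.card → F k = F l →
      ∃ (q : ℕ) (p : ι → ℤ), 0 < q ∧ q ≤ Q ^ S.card ∧ ∀ i ∈ S, |q * α i - p i| ≤ 1 / Q := by
    intro k l hkl hl hF
    refine ⟨l - k, fun i => ⌊l * α i⌋ - ⌊k * α i⌋, by omega, by omega, fun i hi => ?_⟩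
    have h1 : ⌊Int.fract (k * α i) * Q⌋₊ = ⌊Int.fract (l * α i) * Q⌋₊ :=
      congrArg Fin.val (congrFun hF ⟨i, hi⟩)
    have hk0 := Nat.floor_le (a := Int.fract (k * α i) * Q) (by positivity)
    have hl0 := Nat.floor_le (a := Int.fract (l * α i) * Q) (by positivity)
    have hk1 := Nat.lt_floor_add_one (Int.fract (k * α i) * Q)
    have hl1 := Nat.lt_floor_add_one (Int.fract (l * α i) * Q)
    rw [h1] at hk0 hk1
    have : ((l - k : ℕ) : ℝ) * α i - ((⌊l * α i⌋ - ⌊k * α i⌋ : ℤ) : ℝ)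
        = Int.fract (l * α i) - Int.fract (k * α i) := by
      rw [Nat.cast_sub hkl.le]; simp only [Int.fract]; push_cast; ring
    rw [this, le_div_iff₀ hQ', ← abs_of_pos hQ', ← abs_mul, abs_le]
    constructor <;> nlinarith
  simp only [Finset.mem_range] at hk hl
  rcases lt_or_gt_of_ne hkl with h | h
  · exact key k l h (by omega) hF
  · exact key l k h (by omega) hF.symm

/-! ### Lexicographic approximation of integer forms -/

/-- The value of the linear form with integer coefficients `v` at `y`. -/
def intForm {ι : Type*} [Fintype ι] (v : ι → ℤ) (y : ι → ℝ) : ℝ := ∑ o, (v o : ℝ) * y o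

theorem abs_sum_mul_le {ι : Type*} [Fintype ι] {r y : ι → ℝ} {c ρ : ℝ}
    (hr : ∀ o, |r o| ≤ c) (hc : 0 ≤ c) (hy : ∑ o, |y o| ≤ ρ) : |∑ o, r o * y o| ≤ c * ρ := by
  calc |∑ o, r o * y o| ≤ ∑ o, |r o * y o| := Finset.abs_sum_le_sum_abs _ _
    _ ≤ ∑ o, c * |y o| := Finset.sum_le_sum fun o _ => by
        rw [abs_mul]; exact mul_le_mul_of_nonneg_right (hr o) (abs_nonneg _)
    _ = c * ∑ o, |y o| := by rw [Finset.mul_sum]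
    _ ≤ c * ρ := mul_le_mul_of_nonneg_left hy hc

/-- `LexApprox δ B f k W e` says that on `W` the integer form `e` is a lexicographic approximation
of the integer form `f` with `k` layers: each layer `h` has coefficients bounded by `B` and is,
on the set where the previous layers vanish, a multiple of `f` up to an error `δ`, and it dominates
what is left of `e`; where all layers vanish, `e` agrees with `f`. -/
inductive LexApprox {ι : Type*} [Fintype ι] (δ : ℝ) (B : ℕ) (f : ι → ℤ) :
    ℕ → Set (ι → ℝ) → (ι → ℤ) → Prop
  | exact {W : Set (ι → ℝ)} {e : ι → ℤ} (h : ∀ y ∈ W, intForm e y = intForm f y) :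
      LexApprox δ B f 0 W e
  | layer {W : Set (ι → ℝ)} {k : ℕ} (h e : ι → ℤ) (M : ℕ) (t : ℝ) (ht : 0 < t) (htδ : t ≤ δ)
      (hf : ∀ y ∈ W, |t * intForm f y - intForm h y| ≤ δ) (hM : 0 < M)
      (he : ∀ y ∈ W, |intForm e y| + 1 ≤ δ * M) (hB : ∀ o, |h o| ≤ B)
      (hs : LexApprox δ B f k (W ∩ {y | intForm h y = 0}) e) :
      LexApprox δ B f (k + 1) W (fun o => M * h o + e o)

/-- Bound for the coefficients of the approximation of a form whose residual has `m` nonzero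
coefficients. -/
def lexBound (Q n : ℕ) : ℕ → ℕ
  | 0 => Q ^ (n + 1)
  | m + 1 => 2 * Q ^ (m + 1) * lexBound Q n m

theorem pow_le_lexBound {Q : ℕ} (hQ : 0 < Q) (n m : ℕ) : Q ^ (n + 1) ≤ lexBound Q n m := by
  induction m with
  | zero => exact le_rfl
  | succ m ih =>
    refine ih.trans ?_
    have : 0 < Q ^ (m + 1) := by positivity
    exact Nat.le_mul_of_pos_left _ (by positivity)

theorem lexBound_sq (Q n m : ℕ) :
    lexBound Q n m ^ 2 = 4 ^ m * Q ^ (m * (m + 1) + 2 * (n + 1)) := by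
  induction m with
  | zero => simp [lexBound, ← pow_mul]; ring_nf
  | succ m ih =>
    rw [lexBound, mul_pow, ih, mul_pow, ← pow_mul]
    have : (m + 1) * (m + 1 + 1) + 2 * (n + 1)
      = (m + 1) * 2 + (m * (m + 1) + 2 * (n + 1)) := by ring
    rw [this, pow_add Q ((m + 1) * 2), pow_succ 4 m]; ring

/-- Dirichlet is applied to r / |r i₀| only at the nonzero coordinates other than i₀, whence the
exponent m. The coordinate i₀ and the zeros of r are matched exactly, so subtracting the right
multiple of h from r shrinks its support. -/
theorem exists_layer {ι : Type*} [Fintype ι] {Q m : ℕ} (hQ : 1 < Q) (r : ι → ℝ)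
    (hm : (Finset.univ.filter fun o => r o ≠ 0).card ≤ m + 1) (i₀ : ι) (h₀ : r i₀ ≠ 0)
    (hmax : ∀ o, |r o| ≤ |r i₀|) :
    ∃ (q : ℕ) (h : ι → ℤ), 0 < q ∧ q ≤ Q ^ m ∧ (∀ o, |h o| ≤ q) ∧ (h i₀ : ℝ) = q / |r i₀| * r i₀ ∧
      (∀ o, r o = 0 → h o = 0) ∧ ∀ o, |q / |r i₀| * r o - h o| ≤ 1 / Q := by
  classical
  set N := |r i₀| with hN
  have hNpos : 0 < N := abs_pos.2 h₀
  have hQ' : (1 : ℝ) < Q := by exact_mod_cast hQ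
  set S := (Finset.univ.filter fun o => r o ≠ 0) with hS
  obtain ⟨q, p, hq, hqQ, hp⟩ := exists_simultaneous_approx (S.erase i₀) (fun o => r o / N) Q
    (by omega)
  have hi₀ : i₀ ∈ S := by simp [hS, h₀]
  have hcard : (S.erase i₀).card ≤ m := by rw [Finset.card_erase_of_mem hi₀]; omega
  let h : ι → ℤ := fun o => if o = i₀ then (if 0 < r i₀ then q else -q) else if r o = 0 then 0
    else p o
  have hh₀ : (h i₀ : ℝ) = q / N * r i₀ := by
    rcases lt_or_gt_of_ne h₀ with hneg | hpos
    · simp [h, hneg.not_gt, hN, abs_of_neg hneg]; field_simp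
    · simp [h, hpos, hN, abs_of_pos hpos]; field_simp
  have hz : ∀ o, r o = 0 → h o = 0 := by
    intro o ho
    have : o ≠ i₀ := fun e => h₀ (e ▸ ho)
    simp [h, this, ho]
  have hap : ∀ o, |q / N * r o - h o| ≤ 1 / Q := by
    intro o
    by_cases ho : o = i₀
    · subst ho; rw [hh₀]; simp
    by_cases hr : r o = 0
    · rw [hz o hr, hr]; simp
    · have := hp o (by simp [hS, ho, hr])
      have e : (h o : ℝ) = p o := by simp [h, ho, hr]
      rw [e]; convert this using 2; ring
  refine ⟨q, h, hq, hqQ.trans (Nat.pow_le_pow_right (by omega) hcard), fun o => ?_, hh₀, hz, hap⟩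
  -- h o is an integer at distance less than 1 from a number of absolute value at most q.
  have h1 : |(h o : ℝ)| < q + 1 := by
    have a1 := hap o
    have a2 : |q / N * r o| ≤ q := by
      rw [abs_mul, abs_of_nonneg (by positivity), div_mul_eq_mul_div, div_le_iff₀ hNpos]
      exact mul_le_mul_of_nonneg_left (hmax o) (by positivity)
    have a3 : (1 : ℝ) / Q < 1 := by rw [div_lt_one (by linarith)]; exact hQ'
    have a4 := abs_sub_abs_le_abs_sub (h o : ℝ) (q / N * r o)
    rw [abs_sub_comm] at a4
    linarith
  have : |h o| < (q : ℤ) + 1 := by exact_mod_cast h1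
  omega

/-- Two representatives of f on W are carried along: the real residual r, whose support shrinks at
each layer, and an integer form u staying within G of it. G grows by at most Q ^ n per layer, so u
is small as soon as r is. -/
theorem exists_lexApprox_of_residual {ι : Type*} [Fintype ι] {n R Q : ℕ}
    (hQ : 3 * (n + 1) * (R + 2) ≤ Q) (f : ι → ℤ) (m : ℕ) :
    ∀ (W : Set (ι → ℝ)) (u : ι → ℤ) (r : ι → ℝ) (G : ℝ), (∀ y ∈ W, ∑ o, |y o| ≤ R + 1) →
      (Finset.univ.filter fun o => r o ≠ 0).card ≤ m → m ≤ n + 1 →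
      (∀ y ∈ W, ∑ o, r o * y o = intForm f y) → (∀ y ∈ W, intForm u y = intForm f y) →
      (∀ o, |u o - r o| ≤ G) → G + m * (Q : ℝ) ^ n ≤ (n + 1) * (Q : ℝ) ^ n →
      ∃ (k : ℕ) (e : ι → ℤ), LexApprox (1 / (3 * (n + 1))) (Q ^ n) f k W e ∧
        ∀ o, |e o| ≤ lexBound Q n m := by
  have hQ6 : 6 * (n + 1) ≤ Q := by nlinarith
  have hQ1 : 1 < Q := by omega
  have hQR : (3 : ℝ) * (n + 1) * (R + 2) ≤ Q := by exact_mod_cast hQ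
  have hQr : (6 : ℝ) * (n + 1) ≤ Q := by exact_mod_cast hQ6
  have hQ0 : (0 : ℝ) < Q := by positivity
  have hQn : (0 : ℝ) < (Q : ℝ) ^ n := by positivity
  induction m with
  | zero =>
    intro W u r G hW hsupp hm hr hu huG hG
    refine ⟨0, u, .exact hu, fun o => ?_⟩
    have h0 : r o = 0 := by
      by_contra h
      have : o ∈ (Finset.univ.filter fun o => r o ≠ 0) := by simp [h]
      rw [Finset.card_eq_zero.1 (Nat.le_zero.1 hsupp)] at this
      simp at this
    have h1 := huG o
    rw [h0, sub_zero] at h1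
    have : (|u o| : ℝ) ≤ (Q : ℝ) ^ (n + 1) := by
      rw [pow_succ]; push_cast at hG; nlinarith
    rw [lexBound]; exact_mod_cast this
  | succ m ih =>
    intro W u r G hW hsupp hm hr hu huG hG
    -- If r is small, u has coefficients at most Q ^ (n + 1) and no layer is needed. Otherwise |r
    -- i₀| is large enough to force t ≤ 1 / (3 (n + 1)).
    by_cases hsmall : ∀ o, |r o| ≤ 3 * (n + 1) * (Q : ℝ) ^ n
    · refine ⟨0, u, .exact hu, fun o => ?_⟩
      have h1 := huG o
      have h2 := abs_sub_abs_le_abs_sub (u o : ℝ) (r o)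
      have h3 := hsmall o
      have hmQ : (0 : ℝ) ≤ ((m + 1 : ℕ) : ℝ) * (Q : ℝ) ^ n := by positivity
      have h4 : (|u o| : ℝ) ≤ (Q : ℝ) ^ (n + 1) := by
        rw [pow_succ]; nlinarith
      have h5 := pow_le_lexBound (Q := Q) (by omega) n (m + 1)
      have h6 : |u o| ≤ ((Q ^ (n + 1) : ℕ) : ℤ) := by exact_mod_cast h4
      exact h6.trans (by exact_mod_cast h5)
    push Not at hsmall
    obtain ⟨o₁, ho₁⟩ := hsmall
    obtain ⟨i₀, -, hmax⟩ := Finset.exists_max_image Finset.univ (fun o => |r o|) ⟨o₁, by simp⟩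
    replace hmax : ∀ o, |r o| ≤ |r i₀| := fun o => hmax o (by simp)
    have hN : 3 * (n + 1) * (Q : ℝ) ^ n < |r i₀| := ho₁.trans_le (hmax _)
    have hN0 : 0 < |r i₀| := lt_trans (by positivity) hN
    have h₀ : r i₀ ≠ 0 := abs_pos.1 hN0
    obtain ⟨q, h, hq, hqQ, hhq, hh₀, hz, hap⟩ := exists_layer hQ1 r hsupp i₀ h₀ hmax
    set t : ℝ := q / |r i₀| with ht
    have hq0 : (0 : ℝ) < q := by exact_mod_cast hq
    have ht0 : 0 < t := by positivity
    have hqn : (q : ℝ) ≤ (Q : ℝ) ^ n := by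
      exact_mod_cast hqQ.trans (Nat.pow_le_pow_right (by omega) (by omega))
    have htδ : t ≤ 1 / (3 * (n + 1)) := by
      rw [ht, div_le_div_iff₀ hN0 (by positivity)]; nlinarith
    -- On h = 0 any multiple of h may be subtracted: 1/t times h removes i₀ from the support of r,
    -- and the integer part ⌊1/t⌋ keeps u integral at the cost of adding at most q to G.
    obtain ⟨k, e, hke, heb⟩ := ih (W ∩ {y | intForm h y = 0}) (fun o => u o - ⌊1 / t⌋ * h o)
      (fun o => r o - 1 / t * h o) (G + q) (fun y hy => hW y hy.1)
      (by
        refine Nat.lt_succ_iff.1 (lt_of_lt_of_le (Finset.card_lt_card ?_) hsupp)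
        refine Finset.ssubset_iff_of_subset (fun o => ?_) |>.2 ⟨i₀, by simp [h₀], ?_⟩
        · simp only [Finset.mem_filter, Finset.mem_univ, true_and]
          intro hne h0; apply hne; rw [h0, hz o h0]; simp
        · simp only [Finset.mem_filter, Finset.mem_univ, true_and, not_not]
          rw [hh₀]; field_simp; simp)
      (by omega)
      (by
        intro y hy
        have h1 := hr y hy.1
        have h2 : ∑ o, (h o : ℝ) * y o = 0 := hy.2
        simp only [sub_mul, mul_assoc, Finset.sum_sub_distrib, ← Finset.mul_sum, h1, h2]; simp)
      (by
        intro y hy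
        have h1 := hu y hy.1
        have h2 : ∑ o, (h o : ℝ) * y o = 0 := hy.2
        rw [← h1]
        simp only [intForm]; push_cast
        simp only [sub_mul, mul_assoc, Finset.sum_sub_distrib, ← Finset.mul_sum, h2]; simp)
      (by
        intro o
        have e1 : ((u o - ⌊1 / t⌋ * h o : ℤ) : ℝ) - (r o - 1 / t * h o)
          = (u o - r o) + Int.fract (1 / t) * h o := by
          simp only [Int.fract]; push_cast; ring
        rw [e1]
        have e2 : |(h o : ℝ)| ≤ q := by exact_mod_cast hhq o
        have e3 : |Int.fract (1 / t) * h o| ≤ q := by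
          rw [abs_mul, abs_of_nonneg (Int.fract_nonneg _)]
          nlinarith [Int.fract_lt_one (1 / t), Int.fract_nonneg (1 / t), abs_nonneg (h o : ℝ)]
        exact (abs_add_le _ _).trans (add_le_add (huG o) e3))
      (by push_cast at hG; nlinarith)
    have hS1 : (1 : ℝ) ≤ lexBound Q n m := by
      have : 0 < Q ^ (n + 1) := by positivity
      exact_mod_cast this.trans_le (pow_le_lexBound (by omega) n m)
    -- On W the remainder e is at most `lexBound Q n m` * (R + 1), so the factor Q ≥ 3 (n + 1) (R +
    -- 2) in M makes M h dominate it.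
    refine ⟨k + 1, _, .layer h e (Q * lexBound Q n m) t ht0 htδ ?_ ?_ ?_ ?_ hke, ?_⟩
    · intro y hy
      have : t * intForm f y - intForm h y = ∑ o, (t * r o - h o) * y o := by
        rw [← hr y hy]
        simp only [intForm, sub_mul, Finset.sum_sub_distrib, Finset.mul_sum, mul_assoc]
      rw [this]
      refine (abs_sum_mul_le hap (by positivity) (hW y hy)).trans ?_
      rw [one_div_mul_eq_div, div_le_div_iff₀ hQ0 (by positivity)]
      nlinarith
    · have := pow_le_lexBound (Q := Q) (by omega) n m
      have h2 : 0 < Q ^ (n + 1) := by positivity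
      exact Nat.mul_pos (by omega) (by omega)
    · intro y hy
      have h1 : |intForm e y| ≤ lexBound Q n m * (R + 1) := by
        refine abs_sum_mul_le (fun o => ?_) (by positivity) (hW y hy)
        exact_mod_cast heb o
      push_cast
      rw [one_div_mul_eq_div, le_div_iff₀ (by positivity)]
      have h2 : |intForm e y| + 1 ≤ lexBound Q n m * (R + 2) := by nlinarith
      calc (|intForm e y| + 1) * (3 * (n + 1)) ≤ lexBound Q n m * (R + 2) * (3 * (n + 1)) := by
            gcongr
        _ = (3 * (n + 1) * (R + 2)) * lexBound Q n m := by ring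
        _ ≤ _ := by gcongr
    · intro o
      refine (hhq o).trans ?_
      exact_mod_cast hqQ.trans (Nat.pow_le_pow_right (by omega) (by omega))
    · intro o
      have h1 : |h o| ≤ ((Q ^ m : ℕ) : ℤ) := (hhq o).trans (by exact_mod_cast hqQ)
      have h2 := heb o
      have h3 : (1 : ℤ) ≤ ((Q ^ (m + 1) : ℕ) : ℤ) := by
        have : 0 < Q ^ (m + 1) := by positivity
        exact_mod_cast this
      have h4 : |((Q * lexBound Q n m : ℕ) : ℤ) * h o|
          ≤ ((Q ^ (m + 1) : ℕ) : ℤ) * lexBound Q n m := by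
        rw [abs_mul, abs_of_nonneg (by positivity)]
        calc _ ≤ ((Q * lexBound Q n m : ℕ) : ℤ) * ((Q ^ m : ℕ) : ℤ) := by gcongr
          _ = _ := by push_cast; ring
      have h5 : (lexBound Q n m : ℤ) ≤ ((Q ^ (m + 1) : ℕ) : ℤ) * lexBound Q n m :=
        le_mul_of_one_le_left (by positivity) h3
      refine (abs_add_le _ _).trans ?_
      rw [lexBound]; push_cast at *; linarith

theorem exists_lexApprox {ι : Type*} [Fintype ι] {n R Q : ℕ} (hι : Fintype.card ι = n + 1)
    (hQ : 3 * (n + 1) * (R + 2) ≤ Q) (f : ι → ℤ) (W : Set (ι → ℝ))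
    (hW : ∀ y ∈ W, ∑ o, |y o| ≤ R + 1) :
    ∃ (k : ℕ) (e : ι → ℤ), LexApprox (1 / (3 * (n + 1))) (Q ^ n) f k W e ∧
      ∀ o, |e o| ≤ lexBound Q n (n + 1) :=
  exists_lexApprox_of_residual hQ f (n + 1) W f (fun o => f o) 0 hW
    (by rw [← hι]; exact Finset.card_le_univ _) le_rfl (fun _ _ => rfl) (fun _ _ => rfl)
    (by simp) (by push_cast; linarith)

/-! ### Homogeneous coordinates and sides of a disjunction -/

/-- The coefficients of `a x - b` as a linear form in the homogeneous coordinates `(x, -1)`. -/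
def IntIneq.coeffs {n : ℕ} (e : IntIneq n) : Option (Fin n) → ℤ
  | none => e.b
  | some i => e.a i

/-- The inequality with given homogeneous coefficients. -/
def IntIneq.ofCoeffs {n : ℕ} (v : Option (Fin n) → ℤ) : IntIneq n :=
  ⟨fun i => v (some i), v none⟩

/-- The homogeneous coordinates `(x, -1)` of `x`. -/
def homogenize {n : ℕ} (x : Fin n → ℝ) : Option (Fin n) → ℝ
  | none => -1
  | some i => x i

/-- The left side `e` or the right side `e.flip` of a disjunction. -/
def IntIneq.side {n : ℕ} (e : IntIneq n) (σ : Bool) : IntIneq n := if σ then e else e.flip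

/-- The amount by which a point with `a x - b = z` violates the chosen side of the disjunction. -/
def sideVal (σ : Bool) (z : ℝ) : ℝ := if σ then z else 1 - z

section

variable {n : ℕ}

@[simp] theorem IntIneq.coeffs_ofCoeffs (v : Option (Fin n) → ℤ) : (ofCoeffs v).coeffs = v := by
  funext o; cases o <;> rfl

theorem intForm_homogenize (e : IntIneq n) (x : Fin n → ℝ) :
    intForm e.coeffs (homogenize x) = ∑ i, (e.a i : ℝ) * x i - e.b := by
  simp [intForm, Fintype.sum_option, IntIneq.coeffs, homogenize]; ring

theorem IntIneq.mem_halfspace {e : IntIneq n} {x : Fin n → ℝ} :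
    x ∈ e.halfspace ↔ intForm e.coeffs (homogenize x) ≤ 0 := by
  rw [intForm_homogenize, sub_nonpos]; rfl

theorem intForm_flip (e : IntIneq n) (x : Fin n → ℝ) :
    intForm e.flip.coeffs (homogenize x) = 1 - intForm e.coeffs (homogenize x) := by
  rw [intForm_homogenize, intForm_homogenize]
  simp [IntIneq.flip, Finset.sum_neg_distrib]; ring

theorem intForm_side (e : IntIneq n) (σ : Bool) (x : Fin n → ℝ) :
    intForm (e.side σ).coeffs (homogenize x) = sideVal σ (intForm e.coeffs (homogenize x)) := by
  cases σ
  · exact intForm_flip e x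
  · rfl

theorem IntIneq.mem_side_halfspace {e : IntIneq n} {σ : Bool} {x : Fin n → ℝ} :
    x ∈ (e.side σ).halfspace ↔ sideVal σ (intForm e.coeffs (homogenize x)) ≤ 0 := by
  rw [mem_halfspace, intForm_side]

theorem sum_abs_homogenize (x : Fin n → ℝ) : ∑ o, |homogenize x o| = ∑ i, |x i| + 1 := by
  simp [Fintype.sum_option, homogenize, add_comm]

namespace BranchTree

theorem isBranchingProof_leaf {S : Set (Fin n → ℝ)} :
    (leaf : BranchTree n).IsBranchingProof S ↔ S = ∅ := by
  simp [IsBranchingProof, leafPaths]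

theorem isBranchingProof_node {S : Set (Fin n → ℝ)} {e : IntIneq n} {l r : BranchTree n} :
    (node e l r).IsBranchingProof S ↔
      l.IsBranchingProof (S ∩ e.halfspace) ∧ r.IsBranchingProof (S ∩ e.flip.halfspace) := by
  simp only [IsBranchingProof, leafPaths, List.mem_append, List.mem_map, or_imp, forall_and,
    forall_exists_index, and_imp, forall_apply_eq_imp_iff₂, List.mem_cons, forall_eq,
    Set.ext_iff, Set.mem_inter_iff, Set.mem_ofPred_eq, and_assoc]

theorem IsBranchingProof.mono {T : BranchTree n} {S S' : Set (Fin n → ℝ)}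
    (h : T.IsBranchingProof S) (hS : S' ⊆ S) : T.IsBranchingProof S' := fun p hp =>
  Set.subset_eq_empty (Set.inter_subset_inter_left _ hS) (h p hp)

end BranchTree

end

/-! ### What the first layer says about the original form -/

theorem LexApprox.mono {ι : Type*} [Fintype ι] {δ : ℝ} {B : ℕ} {f : ι → ℤ} {k : ℕ}
    {W : Set (ι → ℝ)} {e : ι → ℤ} (h : LexApprox δ B f k W e) :
    ∀ {W' : Set (ι → ℝ)}, W' ⊆ W → LexApprox δ B f k W' e := by
  induction h with
  | exact h => intro W' hW; exact .exact fun y hy => h y (hW hy)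
  | layer h e M t ht htδ hf hM he hB _ ih =>
    intro W' hW
    exact .layer h e M t ht htδ (fun y hy => hf y (hW hy)) hM (fun y hy => he y (hW hy)) hB
      (ih (Set.inter_subset_inter_left _ hW))

theorem LexApprox.eq_of_zero {ι : Type*} [Fintype ι] {δ : ℝ} {B : ℕ} {f : ι → ℤ} {k : ℕ}
    {W : Set (ι → ℝ)} {e : ι → ℤ} (h : LexApprox δ B f k W e) (hk : k = 0) :
    ∀ y ∈ W, intForm e y = intForm f y := by
  cases h with
  | exact h => exact h
  | layer => omega

/-- On `W` the form `h` is `t • f` up to an error `δ`, and satisfying a side of the disjunction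
given by `e` bounds `h` on the same side, up to `δ`. -/
structure IsFirstLayer {ι : Type*} [Fintype ι] (δ : ℝ) (f e h : ι → ℤ) (t : ℝ)
    (W : Set (ι → ℝ)) : Prop where
  pos : 0 < t
  le : t ≤ δ
  approx : ∀ y ∈ W, |t * intForm f y - intForm h y| ≤ δ
  side : ∀ y ∈ W, ∀ σ, sideVal σ (intForm e y) ≤ 0 →
    if σ then intForm h y ≤ δ else -δ ≤ intForm h y

theorem LexApprox.exists_firstLayer {ι : Type*} [Fintype ι] {δ : ℝ} {B : ℕ} {f : ι → ℤ} {k : ℕ}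
    {W : Set (ι → ℝ)} {e : ι → ℤ} (H : LexApprox δ B f k W e) (hk : k ≠ 0) :
    ∃ (h : ι → ℤ) (t : ℝ) (e' : ι → ℤ), IsFirstLayer δ f e h t W ∧ (∀ o, |h o| ≤ B) ∧
      LexApprox δ B f (k - 1) (W ∩ {y | intForm h y = 0}) e' ∧
      ∀ y, intForm h y = 0 → intForm e y = intForm e' y := by
  cases H with
  | exact => exact absurd rfl hk
  | layer h e M t ht htδ hf hM he hB hs =>
    have hval : ∀ y, intForm (fun o => M * h o + e o) y = M * intForm h y + intForm e y := by
      intro y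
      simp only [intForm]; push_cast
      rw [Finset.mul_sum, ← Finset.sum_add_distrib]
      exact Finset.sum_congr rfl fun o _ => by ring
    refine ⟨h, t, e, ⟨ht, htδ, hf, fun y hy σ hσ => ?_⟩, hB, hs, fun y hy => by
      rw [hval, hy]; simp⟩
    have h1 := he y hy
    have hM' : (0 : ℝ) < M := by exact_mod_cast hM
    rw [hval] at hσ
    cases σ
    · simp only [sideVal, Bool.false_eq_true, if_false] at hσ ⊢
      have := le_abs_self (intForm e y)
      by_contra hc
      push Not at hc
      nlinarith
    · simp only [sideVal, if_true] at hσ ⊢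
      have := neg_abs_le (intForm e y)
      by_contra hc
      push Not at hc
      nlinarith

/-- One δ comes from the bound on h and one from the approximation. On the right side the constant 1
in 1 - f contributes t ≤ δ, which makes three. -/
theorem IsFirstLayer.sideVal_le {ι : Type*} [Fintype ι] {δ : ℝ} {f e h : ι → ℤ} {t : ℝ}
    {W : Set (ι → ℝ)} (H : IsFirstLayer δ f e h t W) {y : ι → ℝ} (hy : y ∈ W) {σ : Bool}
    (hσ : sideVal σ (intForm e y) ≤ 0) : sideVal σ (intForm f y) ≤ 3 * δ / t := by
  have h1 := abs_le.1 (H.approx y hy)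
  have h2 := H.side y hy σ hσ
  have h3 := H.le
  have h4 := H.pos
  rw [le_div_iff₀ H.pos]
  cases σ <;> simp [sideVal] at h2 ⊢ <;> nlinarith

/-- Since h is at most δ < 1 in the violating direction, |h| ≥ 1 forces it to be at least 1 in the
satisfying direction. -/
theorem IsFirstLayer.sideVal_le_neg {ι : Type*} [Fintype ι] {δ : ℝ} {f e h : ι → ℤ} {t : ℝ}
    {W : Set (ι → ℝ)} (H : IsFirstLayer δ f e h t W) (hδ : δ < 1) {y : ι → ℝ} (hy : y ∈ W)
    {σ : Bool} (hσ : sideVal σ (intForm e y) ≤ 0) (hh : 1 ≤ |intForm h y|) :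
    sideVal σ (intForm f y) ≤ -(1 - 2 * δ) / t := by
  have h1 := abs_le.1 (H.approx y hy)
  have h2 := H.side y hy σ hσ
  have h3 := H.le
  have h4 := H.pos
  rw [le_div_iff₀ H.pos]
  rcases le_abs.1 hh with h | h <;> cases σ <;> simp [sideVal] at h2 ⊢ <;> nlinarith

/-! ### Closing a leaf with O(n) nodes -/

/-- The points of the `ℓ¹`-ball of radius `ρ` that are orthogonal to `V`. -/
def orthoBall {ι : Type*} [Fintype ι] (ρ : ℝ) (V : Submodule ℝ (ι → ℝ)) : Set (ι → ℝ) :=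
  {y | ∑ o, |y o| ≤ ρ ∧ ∀ v ∈ V, ∑ o, v o * y o = 0}

theorem orthoBall_sup_span {ι : Type*} [Fintype ι] (ρ : ℝ) (V : Submodule ℝ (ι → ℝ))
    (h : ι → ℤ) :
    orthoBall ρ (V ⊔ Submodule.span ℝ {fun o => (h o : ℝ)}) =
      orthoBall ρ V ∩ {y | intForm h y = 0} := by
  ext y
  constructor
  · rintro ⟨h1, h2⟩
    exact ⟨⟨h1, fun v hv => h2 v (Submodule.mem_sup_left hv)⟩,
      h2 _ (Submodule.mem_sup_right (Submodule.mem_span_singleton_self _))⟩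
  · rintro ⟨⟨h1, h2⟩, h3⟩
    refine ⟨h1, fun v hv => ?_⟩
    obtain ⟨w, hw, u, hu, rfl⟩ := Submodule.mem_sup.1 hv
    obtain ⟨c, rfl⟩ := Submodule.mem_span_singleton.1 hu
    have h4 : ∑ o, (h o : ℝ) * y o = 0 := h3
    simp [add_mul, Finset.sum_add_distrib, h2 w hw, mul_assoc, ← Finset.mul_sum, h4]

theorem sum_mul_nonpos_of_dominated {J : Type*} [Fintype J] {δ : ℝ} (hδ : 0 < δ)
    (hJ : 3 * δ * Fintype.card J ≤ 1) {w v : J → ℝ} (i : J) {c : ℝ} (hc : 0 ≤ c)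
    (hi : w i * v i ≤ -(1 - 2 * δ) * c) (h : ∀ j, w j * v j ≤ 3 * δ * c) :
    ∑ j, w j * v j ≤ 0 := by
  classical
  rw [← Finset.add_sum_erase _ _ (Finset.mem_univ i)]
  have h1 : ∑ j ∈ Finset.univ.erase i, w j * v j ≤ ∑ _j ∈ Finset.univ.erase i, 3 * δ * c :=
    Finset.sum_le_sum fun j _ => h j
  have h2 : 0 < Fintype.card J := Fintype.card_pos_iff.2 ⟨i⟩
  rw [Finset.sum_const, Finset.card_erase_of_mem (Finset.mem_univ _), Finset.card_univ,
    nsmul_eq_mul, Nat.cast_sub h2] at h1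
  push_cast at h1
  have h3 : 0 ≤ c * δ := by positivity
  have h4 : 0 ≤ c * (1 - 3 * δ * Fintype.card J) := mul_nonneg hc (by linarith)
  nlinarith

/-- Induction on the total number s of remaining layers. The length is controlled not by s but by
the span V of the layers already forced to vanish: a layer in V costs nothing, and any other costs
four nodes and raises the dimension of V. -/
theorem exists_closing_tree {n R B : ℕ} {J : Type*} [Fintype J] {δ : ℝ} (hδ : 0 < δ)
    (hδ1 : δ < 1) (hJ : 3 * δ * Fintype.card J ≤ 1) (K : Set (Fin n → ℝ)) (f : J → IntIneq n)
    (σ : J → Bool) (w : J → ℝ) (hw : ∀ j, 0 ≤ w j)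
    (hK : ∀ x ∈ K, 0 < ∑ j, w j * sideVal (σ j) (intForm (f j).coeffs (homogenize x))) (s : ℕ) :
    ∀ (k : J → ℕ) (V : Submodule ℝ (Option (Fin n) → ℝ)) (e : J → Option (Fin n) → ℤ),
      ∑ j, k j = s → (∀ j, LexApprox δ B (f j).coeffs (k j) (orthoBall (R + 1) V) (e j)) →
      ∃ T : BranchTree n,
        T.IsBranchingProof {x | x ∈ K ∧ homogenize x ∈ orthoBall (R + 1) V ∧
          ∀ j, sideVal (σ j) (intForm (e j) (homogenize x)) ≤ 0} ∧
        T.length ≤ 1 + 4 * (n + 1 - Module.finrank ℝ V) ∧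
        ∀ g ∈ T.edgeLabels, ∀ o, |g.coeffs o| ≤ B + 1 := by
  classical
  induction s with
  | zero =>
    intro k V e hk he
    refine ⟨.leaf, BranchTree.isBranchingProof_leaf.2 (Set.eq_empty_iff_forall_notMem.2 ?_),
      by simp [BranchTree.length], by simp [BranchTree.edgeLabels]⟩
    rintro x ⟨hx, hxV, hxe⟩
    refine (hK x hx).not_ge (Finset.sum_nonpos fun j _ => mul_nonpos_of_nonneg_of_nonpos (hw j) ?_)
    have hk0 : k j = 0 := by simpa using (Finset.sum_eq_zero_iff.1 hk) j (Finset.mem_univ j)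
    rw [← (he j).eq_of_zero hk0 _ hxV]
    exact hxe j
  | succ s ih =>
    intro k V e hk he
    choose! h t e' hl hB hs hee using fun j => (he j).exists_firstLayer
    have hne : (Finset.univ.filter fun j => k j ≠ 0).Nonempty := by
      by_contra hc
      rw [Finset.not_nonempty_iff_eq_empty, Finset.filter_eq_empty_iff] at hc
      have : ∑ j, k j = 0 := Finset.sum_eq_zero fun j hj => not_not.1 (hc hj)
      omega
    -- Slack and violations are both measured in units of w/t, so the maximal ratio lets inequality
    -- i outweigh the others.
    obtain ⟨i, hi, hmax⟩ := Finset.exists_max_image _ (fun j => w j / t j) hne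
    simp only [Finset.mem_filter, Finset.mem_univ, true_and] at hi hmax
    have hsmall : ∀ x ∈ K, homogenize x ∈ orthoBall (R + 1) V →
        (∀ j, sideVal (σ j) (intForm (e j) (homogenize x)) ≤ 0) →
        |intForm (h i) (homogenize x)| < 1 := by
      intro x hx hxV hxe
      by_contra hc
      push Not at hc
      have hti := (hl i hi).pos
      have hc0 : 0 ≤ w i / t i := div_nonneg (hw i) hti.le
      refine (hK x hx).not_ge (sum_mul_nonpos_of_dominated hδ hJ i hc0 ?_ fun j => ?_)
      · have := (hl i hi).sideVal_le_neg hδ1 hxV (hxe i) hc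
        refine (mul_le_mul_of_nonneg_left this (hw i)).trans (le_of_eq ?_)
        ring
      · by_cases hj : k j = 0
        · rw [← (he j).eq_of_zero hj _ hxV]
          exact (mul_nonpos_of_nonneg_of_nonpos (hw j) (hxe j)).trans (by positivity)
        · have := (hl j hj).sideVal_le hxV (hxe j)
          refine (mul_le_mul_of_nonneg_left this (hw j)).trans ?_
          calc w j * (3 * δ / t j) = 3 * δ * (w j / t j) := by ring
            _ ≤ _ := mul_le_mul_of_nonneg_left (hmax j hj) (by positivity)
    set V' := V ⊔ Submodule.span ℝ {fun o => (h i o : ℝ)} with hV'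
    have hball : orthoBall ((R : ℝ) + 1) V' = orthoBall (R + 1) V ∩ {y | intForm (h i) y = 0} :=
      orthoBall_sup_span _ _ _
    obtain ⟨T, hT, hlen, hlab⟩ := ih (Function.update k i (k i - 1)) V'
      (Function.update e i (e' i))
      (by
        rw [Finset.sum_update_of_mem (Finset.mem_univ i)]
        rw [← Finset.add_sum_erase _ _ (Finset.mem_univ i)] at hk
        rw [Finset.sdiff_singleton_eq_erase]; omega)
      (by
        intro j
        rw [hball]
        by_cases hj : j = i
        · subst hj; simpa using hs j hi
        · simpa [hj] using (he j).mono Set.inter_subset_left)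
    have hsub : ∀ x, x ∈ K → homogenize x ∈ orthoBall (R + 1) V →
        (∀ j, sideVal (σ j) (intForm (e j) (homogenize x)) ≤ 0) →
        intForm (h i) (homogenize x) = 0 →
        x ∈ {x | x ∈ K ∧ homogenize x ∈ orthoBall (R + 1) V' ∧
          ∀ j, sideVal (σ j) (intForm (Function.update e i (e' i) j) (homogenize x)) ≤ 0} := by
      intro x hx hxV hxe h0
      refine ⟨hx, by rw [hball]; exact ⟨hxV, h0⟩, fun j => ?_⟩
      by_cases hj : j = i
      · subst hj; simpa [← hee j hi _ h0] using hxe j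
      · simpa [hj] using hxe j
    by_cases hmem : (fun o => (h i o : ℝ)) ∈ V
    · have hVV : V' = V := sup_eq_left.2 (by simpa using hmem)
      refine ⟨T, hT.mono ?_, by rwa [hVV] at hlen, hlab⟩
      rintro x ⟨hx, hxV, hxe⟩
      exact hsub x hx hxV hxe (hxV.2 _ hmem)
    · have hlt : V < V' := lt_of_le_of_ne le_sup_left fun heq => hmem (by
        rw [heq]; exact Submodule.mem_sup_right (Submodule.mem_span_singleton_self _))
      have hfin := Submodule.finrank_lt_finrank_of_lt hlt
      have hfin' : Module.finrank ℝ V' ≤ n + 1 := by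
        simpa using Submodule.finrank_le V'
      let g : IntIneq n := .ofCoeffs (h i)
      let g' : IntIneq n := ⟨g.a, g.b - 1⟩
      have hg' : ∀ x, intForm g'.coeffs (homogenize x) = intForm (h i) (homogenize x) + 1 := by
        intro x
        have : intForm g.coeffs (homogenize x) = intForm (h i) (homogenize x) := by simp [g]
        rw [← this, intForm_homogenize, intForm_homogenize]; simp [g']; ring
      have hg : g.coeffs = h i := IntIneq.coeffs_ofCoeffs _
      -- The branches are h ≤ -1 or h ≥ 0, then h ≤ 0 or h ≥ 1. Both leaves are empty because |h| <
      -- 1, and T handles h = 0. The shifted right-hand side accounts for B + 1.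
      refine ⟨.node g' .leaf (.node g T .leaf), ?_, ?_, ?_⟩
      · rw [BranchTree.isBranchingProof_node, BranchTree.isBranchingProof_node,
          BranchTree.isBranchingProof_leaf, BranchTree.isBranchingProof_leaf]
        refine ⟨Set.eq_empty_iff_forall_notMem.2 ?_, hT.mono ?_,
          Set.eq_empty_iff_forall_notMem.2 ?_⟩
        · rintro x ⟨⟨hx, hxV, hxe⟩, h1⟩
          rw [IntIneq.mem_halfspace, hg'] at h1
          have := abs_lt.1 (hsmall x hx hxV hxe)
          linarith
        · rintro x ⟨⟨⟨hx, hxV, hxe⟩, h1⟩, h2⟩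
          rw [IntIneq.mem_halfspace, intForm_flip, hg'] at h1
          rw [IntIneq.mem_halfspace, hg] at h2
          exact hsub x hx hxV hxe (by linarith)
        · rintro x ⟨⟨⟨hx, hxV, hxe⟩, -⟩, h2⟩
          rw [IntIneq.mem_halfspace, intForm_flip, hg] at h2
          have := abs_lt.1 (hsmall x hx hxV hxe)
          linarith
      · simp only [BranchTree.length]; omega
      · have hBi := hB i hi
        intro e₁ he₁ o
        simp only [BranchTree.edgeLabels, List.mem_cons, List.mem_append, List.not_mem_nil,
          false_or, or_false] at he₁
        have hBo := abs_le.1 (hBi o)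
        rcases he₁ with rfl | rfl | rfl | rfl | he₁
        · rcases o with _ | o <;>
            simp only [g', g, IntIneq.coeffs, IntIneq.ofCoeffs] <;>
            rw [abs_le] <;> omega
        · rcases o with _ | o <;>
            simp only [g', g, IntIneq.coeffs, IntIneq.ofCoeffs, IntIneq.flip] <;>
            rw [abs_le] <;> omega
        · rcases o with _ | o <;>
            simp only [g, IntIneq.coeffs, IntIneq.ofCoeffs] <;>
            rw [abs_le] <;> omega
        · rcases o with _ | o <;>
            simp only [g, IntIneq.coeffs, IntIneq.ofCoeffs, IntIneq.flip] <;>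
            rw [abs_le] <;> omega
        · exact hlab e₁ he₁ o

/-! ### Helly and Farkas -/

/-- A finite family of convex sets that has no common point in `K ⊆ ℝⁿ` has a subfamily of at
most `n + 1` members with the same property. -/
theorem exists_small_infeasible_subfamily {n : ℕ} {K : Set (Fin n → ℝ)} (hK : Convex ℝ K)
    {α : Type*} (s : Finset α) (H : α → Set (Fin n → ℝ)) (hH : ∀ p ∈ s, Convex ℝ (H p))
    (h : ∀ x ∈ K, ∃ p ∈ s, x ∉ H p) :
    ∃ I ⊆ s, I.card ≤ n + 1 ∧ ∀ x ∈ K, ∃ p ∈ I, x ∉ H p := by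
  by_contra hc
  push Not at hc
  -- K is nonempty, hence so is the family; a member p₀ is needed to place Helly's common point in
  -- K.
  obtain ⟨x₀, hx₀, -⟩ := hc ∅ (Finset.empty_subset _) (by simp)
  obtain ⟨p₀, hp₀, -⟩ := h x₀ hx₀
  have := Convex.helly_theorem' (𝕜 := ℝ) (F := fun p => K ∩ H p) (s := s)
    (fun p hp => hK.inter (hH p hp)) (fun I hI hcard => by
      obtain ⟨x, hx, hxI⟩ := hc I hI (by simpa using hcard)
      exact ⟨x, Set.mem_iInter₂.2 fun p hp => ⟨hx, hxI p hp⟩⟩)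
  obtain ⟨x, hx⟩ := this
  rw [Set.mem_iInter₂] at hx
  obtain ⟨p, hp, hxp⟩ := h x (hx p₀ hp₀).1
  exact hxp (hx p hp).2

/-- Farkas' lemma relative to a compact convex set. -/
theorem exists_farkas_multipliers {n : ℕ} {K : Set (Fin n → ℝ)} (hK : IsCompact K)
    (hKc : Convex ℝ K) {J : Type*} [Fintype J] (g : J → IntIneq n)
    (h : ∀ x ∈ K, ∃ j, x ∉ (g j).halfspace) :
    ∃ w : J → ℝ, (∀ j, 0 ≤ w j) ∧
      ∀ x ∈ K, 0 < ∑ j, w j * intForm (g j).coeffs (homogenize x) := by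
  classical
  let Φ : (Fin n → ℝ) → J → ℝ := fun x j => intForm (g j).coeffs (homogenize x)
  have hΦ : ∀ x j, Φ x j = ∑ i, ((g j).a i : ℝ) * x i - (g j).b := fun x j =>
    intForm_homogenize _ _
  have hcont : Continuous Φ := by
    refine continuous_pi fun j => ?_
    simp only [hΦ]; fun_prop
  have hconv : Convex ℝ (Φ '' K) := by
    rintro _ ⟨x, hx, rfl⟩ _ ⟨y, hy, rfl⟩ a b ha hb hab
    refine ⟨a • x + b • y, hKc hx hy ha hb hab, funext fun j => ?_⟩
    simp only [hΦ, Pi.add_apply, Pi.smul_apply, smul_eq_mul, mul_add, Finset.sum_add_distrib,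
      mul_sub, Finset.mul_sum]
    have : ((g j).b : ℝ) = a * (g j).b + b * (g j).b := by rw [← add_mul, hab, one_mul]
    rw [show ∑ i, ((g j).a i : ℝ) * (a * x i) = ∑ i, a * (((g j).a i : ℝ) * x i) from
      Finset.sum_congr rfl fun i _ => by ring,
      show ∑ i, ((g j).a i : ℝ) * (b * y i) = ∑ i, b * (((g j).a i : ℝ) * y i) from
      Finset.sum_congr rfl fun i _ => by ring]
    linarith
  have hdisj : Disjoint (Set.Iic (0 : J → ℝ)) (Φ '' K) := by
    rw [Set.disjoint_left]
    rintro _ hz ⟨x, hx, rfl⟩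
    obtain ⟨j, hj⟩ := h x hx
    exact hj (IntIneq.mem_halfspace.2 (hz j))
  obtain ⟨φ, u, v, hu, huv, hv⟩ := geometric_hahn_banach_closed_compact (convex_Iic (0 : J → ℝ))
    isClosed_Iic hconv (hK.image hcont) hdisj
  have hu0 : 0 < u := by simpa using hu 0 (Set.mem_Iic.2 le_rfl)
  have hrep : ∀ z : J → ℝ, φ z = ∑ j, φ (Pi.single j 1) * z j := by
    intro z
    conv_lhs => rw [← Finset.univ_sum_single z]
    rw [map_sum]
    refine Finset.sum_congr rfl fun j _ => ?_
    have : (Pi.single j (z j) : J → ℝ) = z j • Pi.single j 1 := by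
      rw [← Pi.single_smul]; simp
    rw [this, map_smul, smul_eq_mul, mul_comm]
  refine ⟨fun j => φ (Pi.single j 1), fun j => ?_, fun x hx => ?_⟩
  · by_contra hneg
    push Not at hneg
    -- With a negative weight, this point of the nonpositive orthant would have φ-value exactly u,
    -- against strict separation.
    have := hu ((u / φ (Pi.single j 1)) • Pi.single j 1) (by
      rw [Set.mem_Iic]
      intro l
      have hd : u / φ (Pi.single j 1) ≤ 0 := (div_neg_of_pos_of_neg hu0 hneg).le
      by_cases hl : l = j
      · subst hl; simpa using hd
      · simp [hl])
    rw [map_smul, smul_eq_mul, div_mul_cancel₀ _ hneg.ne] at this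
    exact lt_irrefl _ this
  · have := hv _ ⟨x, hx, rfl⟩
    rw [hrep] at this
    exact (hu0.trans huv).trans this

theorem IntIneq.convex_halfspace {n : ℕ} (e : IntIneq n) : Convex ℝ e.halfspace :=
  convex_halfSpace_le (f := fun x : Fin n → ℝ => ∑ i, (e.a i : ℝ) * x i)
    ⟨fun x y => by simp [mul_add, Finset.sum_add_distrib],
      fun c x => by
        simp only [Pi.smul_apply, smul_eq_mul, Finset.mul_sum]
        exact Finset.sum_congr rfl fun i _ => by ring⟩ _

theorem orthoBall_bot {ι : Type*} [Fintype ι] (ρ : ℝ) :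
    orthoBall ρ (⊥ : Submodule ℝ (ι → ℝ)) = {y | ∑ o, |y o| ≤ ρ} := by
  ext y; simp [orthoBall]

/-! ### Bit-sizes -/

theorem ratBitSize_intCast (p : ℤ) : ratBitSize (p : ℚ) = 2 + Nat.clog 2 (p.natAbs + 1) := by
  have : Nat.clog 2 2 = 1 := by simpa using Nat.clog_pow 2 1 (by norm_num)
  simp [ratBitSize, this]; omega

theorem IntIneq.bitSize_le {n Z : ℕ} (e : IntIneq n) (h : ∀ o, |e.coeffs o| ≤ Z) :
    e.bitSize ≤ n + (n + 1) * (2 + Nat.clog 2 (Z + 1)) := by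
  have key : ∀ p : ℤ, |p| ≤ Z → ratBitSize (p : ℚ) ≤ 2 + Nat.clog 2 (Z + 1) := by
    intro p hp
    rw [ratBitSize_intCast]
    have : p.natAbs ≤ Z := by rw [Int.abs_eq_natAbs] at hp; exact_mod_cast hp
    exact Nat.add_le_add_left (Nat.clog_mono_right 2 (by omega)) 2
  have h1 : ∑ i, ratBitSize (e.a i : ℚ) ≤ ∑ _i : Fin n, (2 + Nat.clog 2 (Z + 1)) :=
    Finset.sum_le_sum fun i _ => key _ (h (some i))
  have h2 := key _ (h none)
  simp only [Finset.sum_const, Finset.card_univ, Fintype.card_fin, smul_eq_mul] at h1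
  simp only [IntIneq.bitSize, vecBitSize]
  change ratBitSize (e.b : ℚ) ≤ _ at h2
  rw [add_mul, one_mul]; omega

namespace BranchTree

theorem bitSize_node {n : ℕ} (e : IntIneq n) (l r : BranchTree n) :
    (node e l r).bitSize =
      3 + 2 * e.bitSize + e.flip.bitSize + l.bitSize + r.bitSize := by
  simp [bitSize, length, edgeLabels, nodeLabels]; ring

theorem bitSize_le {n b : ℕ} (T : BranchTree n) (h : ∀ e ∈ T.edgeLabels, e.bitSize ≤ b) :
    T.bitSize ≤ (3 + 3 * b) * T.length := by
  induction T with
  | leaf => simp [bitSize, length, edgeLabels, nodeLabels]; omega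
  | node e l r ihl ihr =>
    have h1 := h e (by simp [edgeLabels])
    have h2 := h e.flip (by simp [edgeLabels])
    have h3 := ihl fun g hg => h g (by simp [edgeLabels, hg])
    have h4 := ihr fun g hg => h g (by simp [edgeLabels, hg])
    rw [bitSize_node, length, mul_add, mul_add]; omega

end BranchTree

/-! ### Rounding the whole tree -/

/-- L records the current path as triples (original label, rounded label, side). The bit budgets are
separate: the 4n + 5 nodes of a closing tree use only labels of size `b₁`, while the larger `b₂` is
paid once per original node. This keeps the total cubic in n. -/
theorem exists_rounded_tree {n R Q Z : ℕ} (hQ : 3 * (n + 1) * (R + 2) ≤ Q)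
    (hZ : lexBound Q n (n + 1) + 1 ≤ Z) {K : Set (Fin n → ℝ)} (hK : IsCompact K)
    (hKc : Convex ℝ K) (hKR : K ⊆ {x | ∑ i, |x i| ≤ (R : ℝ)}) {b₁ b₂ : ℕ}
    (hb₁ : ∀ e : IntIneq n, (∀ o, |e.coeffs o| ≤ ((Q ^ n + 1 : ℕ) : ℤ)) → e.bitSize ≤ b₁)
    (hb₂ : ∀ e : IntIneq n, (∀ o, |e.coeffs o| ≤ Z) → e.bitSize ≤ b₂) (T : BranchTree n) :
    ∀ L : List (IntIneq n × IntIneq n × Bool),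
      (∀ p ∈ L, ∃ k, LexApprox (1 / (3 * (n + 1))) (Q ^ n) p.1.coeffs k
        (orthoBall (R + 1) ⊥) p.2.1.coeffs) →
      T.IsBranchingProof {x | x ∈ K ∧ ∀ p ∈ L, x ∈ (p.1.side p.2.2).halfspace} →
      ∃ T' : BranchTree n,
        T'.IsBranchingProof {x | x ∈ K ∧ ∀ p ∈ L, x ∈ (p.2.1.side p.2.2).halfspace} ∧
        T'.length ≤ (4 * n + 5) * T.length ∧
        (∀ e ∈ T'.edgeLabels, ∀ o, |e.coeffs o| ≤ Z) ∧
        T'.bitSize ≤ ((3 + 3 * b₁) * (4 * n + 5) + (3 + 3 * b₂)) * T.length := by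
  classical
  induction T with
  | leaf =>
    intro L hL hT
    rw [BranchTree.isBranchingProof_leaf] at hT
    obtain ⟨I, hIL, hIcard, hI⟩ := exists_small_infeasible_subfamily hKc L.toFinset
      (fun p => (p.1.side p.2.2).halfspace) (fun p _ => IntIneq.convex_halfspace _) (by
        intro x hx
        by_contra hc
        push Not at hc
        exact Set.eq_empty_iff_forall_notMem.1 hT x ⟨hx, fun p hp => hc p (by simpa using hp)⟩)
    have hIL' : ∀ p ∈ I, p ∈ L := fun p hp => by simpa using hIL hp
    obtain ⟨w, hw, hwK⟩ := exists_farkas_multipliers hK hKc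
      (fun j : I => (j.1.1.side j.1.2.2)) (fun x hx => by
        obtain ⟨p, hp, hxp⟩ := hI x hx
        exact ⟨⟨p, hp⟩, hxp⟩)
    simp only [intForm_side] at hwK
    choose k hk using fun j : I => hL j.1 (hIL' j.1 j.2)
    have hδ1 : (1 : ℝ) / (3 * (n + 1)) < 1 := by
      rw [div_lt_one (by positivity)]; linarith [(Nat.cast_nonneg n : (0 : ℝ) ≤ n)]
    obtain ⟨T', hT', hlen, hlab⟩ := exists_closing_tree (R := R) (B := Q ^ n)
      (δ := 1 / (3 * (n + 1))) (by positivity) hδ1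
      -- The choice δ = 1 / (3 (n + 1)) is exactly what n + 1 inequalities from Helly require.
      (by
        have : (I.card : ℝ) ≤ n + 1 := by exact_mod_cast hIcard
        rw [Fintype.card_coe]
        calc 3 * (1 / (3 * ((n : ℝ) + 1))) * I.card ≤ 3 * (1 / (3 * ((n : ℝ) + 1))) * (n + 1) := by
              gcongr
          _ = 1 := by field_simp)
      K (fun j : I => j.1.1) (fun j => j.1.2.2) w hw hwK _ k ⊥ (fun j => j.1.2.1.coeffs) rfl hk
    rw [finrank_bot] at hlen
    have hbits := T'.bitSize_le fun e he => hb₁ e (by exact_mod_cast hlab e he)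
    refine ⟨T', hT'.mono ?_, ?_, fun e he o => (hlab e he o).trans ?_, ?_⟩
    · rintro x ⟨hx, hxL⟩
      refine ⟨hx, ?_, fun j => IntIneq.mem_side_halfspace.1 (hxL _ (hIL' _ j.2))⟩
      rw [orthoBall_bot]
      change ∑ o, |homogenize x o| ≤ _
      rw [sum_abs_homogenize]
      have : ∑ i, |x i| ≤ (R : ℝ) := hKR hx
      linarith
    · simp only [BranchTree.length]; omega
    · have h1 : 0 < Q := by nlinarith
      have h2 := pow_le_lexBound h1 n (n + 1)
      have h3 : Q ^ n ≤ Q ^ (n + 1) := Nat.pow_le_pow_right h1 (by omega)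
      exact_mod_cast (by omega : Q ^ n + 1 ≤ Z)
    · have : T'.length ≤ 4 * n + 5 := by omega
      simp only [BranchTree.length, mul_one]
      exact hbits.trans ((Nat.mul_le_mul_left _ this).trans (Nat.le_add_right _ _))
  | node f l r ihl ihr =>
    intro L hL hT
    obtain ⟨hTl, hTr⟩ := BranchTree.isBranchingProof_node.1 hT
    obtain ⟨k, e, hke, hle⟩ := exists_lexApprox (by simp) hQ f.coeffs
      (orthoBall (R + 1) (⊥ : Submodule ℝ (Option (Fin n) → ℝ))) (fun y hy => hy.1)
    have hgood : ∀ σ, ∀ p ∈ (f, IntIneq.ofCoeffs e, σ) :: L,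
        ∃ k, LexApprox (1 / (3 * (n + 1))) (Q ^ n) p.1.coeffs k
          (orthoBall (R + 1) ⊥) p.2.1.coeffs := by
      intro σ p hp
      rcases List.mem_cons.1 hp with rfl | hp
      · exact ⟨k, by simpa using hke⟩
      · exact hL p hp
    obtain ⟨Tl, hl1, hl2, hl3, hl4⟩ := ihl ((f, .ofCoeffs e, true) :: L) (hgood true)
      (hTl.mono (by
        rintro x ⟨hx, hxL⟩
        exact ⟨⟨hx, fun p hp => hxL p (List.mem_cons_of_mem _ hp)⟩, hxL (f, .ofCoeffs e, true)
          List.mem_cons_self⟩))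
    obtain ⟨Tr, hr1, hr2, hr3, hr4⟩ := ihr ((f, .ofCoeffs e, false) :: L) (hgood false)
      (hTr.mono (by
        rintro x ⟨hx, hxL⟩
        exact ⟨⟨hx, fun p hp => hxL p (List.mem_cons_of_mem _ hp)⟩, hxL (f, .ofCoeffs e, false)
          List.mem_cons_self⟩))
    have hbe : ∀ o, |(IntIneq.ofCoeffs e).coeffs o| ≤ Z := fun o => by
      have := hle o
      rw [IntIneq.coeffs_ofCoeffs]; omega
    have hbf : ∀ o, |(IntIneq.ofCoeffs e).flip.coeffs o| ≤ Z := fun o => by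
      have := abs_le.1 (hle o)
      rcases o with _ | o <;> simp only [IntIneq.coeffs, IntIneq.ofCoeffs, IntIneq.flip] <;>
        rw [abs_le] <;> omega
    refine ⟨.node (.ofCoeffs e) Tl Tr, BranchTree.isBranchingProof_node.2
      ⟨hl1.mono ?_, hr1.mono ?_⟩, ?_, ?_, ?_⟩
    · rintro x ⟨⟨hx, hxL⟩, hxe⟩
      refine ⟨hx, fun p hp => ?_⟩
      rcases List.mem_cons.1 hp with rfl | hp
      · exact hxe
      · exact hxL p hp
    · rintro x ⟨⟨hx, hxL⟩, hxe⟩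
      refine ⟨hx, fun p hp => ?_⟩
      rcases List.mem_cons.1 hp with rfl | hp
      · exact hxe
      · exact hxL p hp
    · simp only [BranchTree.length, mul_add]; omega
    · intro g hg
      simp only [BranchTree.edgeLabels, List.mem_cons, List.mem_append] at hg
      rcases hg with rfl | rfl | hg | hg
      · exact hbe
      · exact hbf
      · exact hl3 g hg
      · exact hr3 g hg
    · have h1 := hb₂ _ hbe
      have h2 := hb₂ _ hbf
      rw [BranchTree.bitSize_node, BranchTree.length, mul_add, mul_add, mul_one]
      omega

/-! ### Numerical estimates and conclusion -/

theorem lexBound_add_one_le {n R : ℕ} (hn : 1 ≤ n) (hR : 1 ≤ R) :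
    lexBound (18 * n * R) n (n + 1) + 1 ≤ (10 * n * R) ^ ((n + 2) ^ 2) := by
  have hnR : 1 ≤ n * R := Nat.mul_pos hn hR
  set X := 10 * n * R with hX
  have hX' : X = 10 * (n * R) := by rw [hX]; ring
  set Q := 18 * n * R with hQ
  have hQ' : Q = 18 * (n * R) := by rw [hQ]; ring
  have hX4 : 4 ≤ X := by omega
  have hQX : Q ^ 2 ≤ X ^ 3 := by
    rw [hQ', hX', mul_pow 18, mul_pow 10]
    exact Nat.mul_le_mul (by norm_num) (Nat.pow_le_pow_right hnR (by norm_num))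
  set S := lexBound Q n (n + 1) with hS
  have hS1 : 1 ≤ S := by
    have h1 : 0 < Q := by omega
    have h2 : 0 < Q ^ (n + 1) := by positivity
    exact h2.trans_le (pow_le_lexBound h1 n (n + 1))
  refine (by omega : S + 1 ≤ 2 * S).trans ?_
  -- The fourth power clears the halves in the exponent of `lexBound` and in Q ≤ X ^ (3/2). The
  -- final comparison of exponents amounts to n ≤ n ^ 2.
  have key : (2 * S) ^ 4 ≤ (X ^ ((n + 2) ^ 2)) ^ 4 := by
    calc (2 * S) ^ 4 = 16 * (S ^ 2) ^ 2 := by ring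
      _ = 4 ^ (2 * (n + 2)) * (Q ^ 2) ^ ((n + 1) * (n + 4)) := by
        rw [hS, lexBound_sq]
        ring_nf
      _ ≤ X ^ (2 * (n + 2)) * (X ^ 3) ^ ((n + 1) * (n + 4)) :=
        Nat.mul_le_mul (Nat.pow_le_pow_left hX4 _) (Nat.pow_le_pow_left hQX _)
      _ = X ^ (2 * (n + 2) + 3 * ((n + 1) * (n + 4))) := by rw [← pow_mul, ← pow_add]
      _ ≤ X ^ ((n + 2) ^ 2 * 4) := Nat.pow_le_pow_right (by omega) (by nlinarith)
      _ = _ := by rw [pow_mul]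
  exact (Nat.pow_le_pow_iff_left (by norm_num)).1 key

theorem clog_two_le {m Y j : ℕ} (hY : 2 ≤ Y) (hm : m ≤ Y ^ j) :
    (Nat.clog 2 m : ℝ) ≤ (j + 1) * Real.logb 2 Y := by
  have h1 : (1 : ℝ) ≤ Real.logb 2 Y := by
    rw [Real.le_logb_iff_rpow_le (by norm_num) (by positivity)]
    simpa using (by exact_mod_cast hY : (2 : ℝ) ≤ Y)
  have h2 : Nat.clog 2 m ≤ Nat.clog 2 (Y ^ j) := Nat.clog_mono_right 2 hm
  have h3 : (Nat.clog 2 (Y ^ j) : ℝ) ≤ j * Real.logb 2 Y + 1 := by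
    rw [← Real.natCeil_logb_natCast]
    have h4 : Real.logb ((2 : ℕ) : ℝ) ((Y ^ j : ℕ) : ℝ) = j * Real.logb 2 Y := by
      push_cast; rw [Real.logb_pow]
    rw [h4]
    exact (Nat.ceil_lt_add_one (by positivity)).le
  have h5 : (Nat.clog 2 m : ℝ) ≤ Nat.clog 2 (Y ^ j) := by exact_mod_cast h2
  linarith

theorem theorem1 :
    ∃ C : ℝ, 0 < C ∧ ∀ (n R : ℕ), 1 ≤ n → 1 ≤ R →
      ∀ K : Set (Fin n → ℝ), IsCompact K → Convex ℝ K → IntegerFree K →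
        K ⊆ {x | ∑ i, |x i| ≤ (R : ℝ)} →
        ∀ T : BranchTree n, T.IsBranchingProof K →
          ∃ T' : BranchTree n, T'.IsBranchingProof K ∧
            (T'.length : ℝ) ≤ C * (n * T.length) ∧
            (∀ e ∈ T'.edgeLabels,
              (∀ i, |e.a i| ≤ (10 * (n : ℤ) * (R : ℤ)) ^ ((n + 2) ^ 2)) ∧
                |e.b| ≤ (10 * (n : ℤ) * (R : ℤ)) ^ ((n + 2) ^ 2)) ∧
            (T'.bitSize : ℝ) ≤
              C * ((n : ℝ) ^ 3 * Real.logb 2 (2 * (n : ℝ) * (R : ℝ)) * T.length) := by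
  refine ⟨2000, by norm_num, fun n R hn hR K hK hKc _ hKR T hT => ?_⟩
  have hnR : 1 ≤ n * R := Nat.mul_pos hn hR
  set Y := 2 * n * R with hY
  have hY' : Y = 2 * (n * R) := by rw [hY]; ring
  have hY2 : 2 ≤ Y := by omega
  have hY4 : 16 ≤ Y ^ 4 := Nat.pow_le_pow_left hY2 4
  have hY3 : 8 ≤ Y ^ 3 := Nat.pow_le_pow_left hY2 3
  -- The value 18nR comes from n + 1 ≤ 2n and R + 2 ≤ 3R.
  have hQ : 3 * (n + 1) * (R + 2) ≤ 18 * n * R := by nlinarith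
  have hQY : 18 * n * R ≤ Y ^ 5 := by
    have : 18 * n * R = 9 * Y := by rw [hY]; ring
    rw [this, pow_succ]; exact Nat.mul_le_mul_right _ (by omega)
  have hXY : 10 * n * R ≤ Y ^ 4 := by
    have : 10 * n * R = 5 * Y := by rw [hY]; ring
    rw [this, pow_succ]; exact Nat.mul_le_mul_right _ (by omega)
  set Z := (10 * n * R) ^ ((n + 2) ^ 2) with hZdef
  obtain ⟨T', h1, h2, h3, h4⟩ := exists_rounded_tree hQ (lexBound_add_one_le hn hR) hK hKc hKR
    (fun e he => e.bitSize_le he) (fun e he => e.bitSize_le he) T [] (by simp) (by simpa using hT)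
  refine ⟨T', by simpa using h1, ?_, fun e he => ⟨fun i => ?_, ?_⟩, ?_⟩
  · have h5 : T'.length ≤ 2000 * (n * T.length) := by
      refine h2.trans ?_
      rw [← mul_assoc]; exact Nat.mul_le_mul_right _ (by omega)
    exact_mod_cast h5
  · exact_mod_cast h3 e he (some i)
  · exact_mod_cast h3 e he none
  · have hb₁ : (Nat.clog 2 ((18 * n * R) ^ n + 1 + 1) : ℝ)
        ≤ ((5 * (n + 1) : ℕ) + 1) * Real.logb 2 Y := by
      refine clog_two_le hY2 ?_
      rw [pow_mul]
      refine le_trans ?_ (Nat.pow_le_pow_left hQY (n + 1))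
      have hq : 18 ≤ 18 * n * R := by rw [mul_assoc]; omega
      have : 1 ≤ (18 * n * R) ^ n := Nat.one_le_pow _ _ (by omega)
      rw [pow_succ]; nlinarith
    have hb₂ : (Nat.clog 2 (Z + 1) : ℝ)
        ≤ ((4 * (n + 2) ^ 2 + 1 : ℕ) + 1) * Real.logb 2 Y := by
      refine clog_two_le hY2 ?_
      have h5 : Z ≤ Y ^ (4 * (n + 2) ^ 2) := by
        rw [pow_mul]; exact Nat.pow_le_pow_left hXY _
      have h6 : 1 ≤ Y ^ (4 * (n + 2) ^ 2) := Nat.one_le_pow _ _ (by omega)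
      rw [pow_succ Y]; nlinarith
    have hYc : (2 * (n : ℝ) * (R : ℝ)) = (Y : ℝ) := by rw [hY]; push_cast; ring
    rw [hYc]
    set ℓ := Real.logb 2 (Y : ℝ) with hℓ
    have hℓ1 : 1 ≤ ℓ := by
      rw [hℓ, Real.le_logb_iff_rpow_le (by norm_num) (by positivity)]
      simpa using (by exact_mod_cast hY2 : (2 : ℝ) ≤ Y)
    have hN : (1 : ℝ) ≤ n := by exact_mod_cast hn
    have hB₁ : ((n : ℝ) + (n + 1) * (2 + Nat.clog 2 ((18 * n * R) ^ n + 1 + 1)))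
        ≤ 27 * (n ^ 2 * ℓ) := by
      push_cast at hb₁
      have a1 : (2 : ℝ) + Nat.clog 2 ((18 * n * R) ^ n + 1 + 1) ≤ 13 * (n * ℓ) := by nlinarith
      have a2 : (n : ℝ) ≤ n ^ 2 * ℓ := by nlinarith [mul_nonneg (sub_nonneg.2 hN) (sub_nonneg.2 hℓ1)]
      calc _ ≤ (n ^ 2 * ℓ) + (n + n) * (13 * (n * ℓ)) := by gcongr
        _ = _ := by ring
    have hB₂ : ((n : ℝ) + (n + 1) * (2 + Nat.clog 2 (Z + 1))) ≤ 81 * (n ^ 3 * ℓ) := by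
      push_cast at hb₂
      have a0 : ((n : ℝ) + 2) ^ 2 ≤ 9 * n ^ 2 := by nlinarith
      have a3 : (1 : ℝ) ≤ n ^ 2 := by nlinarith
      have a1 : (2 : ℝ) + Nat.clog 2 (Z + 1) ≤ 40 * (n ^ 2 * ℓ) := by
        have : (4 * ((n : ℝ) + 2) ^ 2 + 1 + 1) * ℓ ≤ (38 * n ^ 2) * ℓ := by
          gcongr; linarith
        have : 1 ≤ (n : ℝ) ^ 2 * ℓ := by nlinarith
        linarith
      have a2 : (n : ℝ) ≤ n ^ 3 * ℓ := by
        have : (n : ℝ) ≤ n ^ 3 := by nlinarith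
        nlinarith
      calc _ ≤ (n ^ 3 * ℓ) + (n + n) * (40 * (n ^ 2 * ℓ)) := by gcongr
        _ = _ := by ring
    have h5 : (T'.bitSize : ℝ) ≤ ((3 + 3 * ((n : ℝ) + (n + 1) *
        (2 + Nat.clog 2 ((18 * n * R) ^ n + 1 + 1)))) * (4 * n + 5)
        + (3 + 3 * ((n : ℝ) + (n + 1) * (2 + Nat.clog 2 (Z + 1))))) * T.length := by
      exact_mod_cast h4
    refine h5.trans ?_
    rw [← mul_assoc]
    gcongr
    have a1 : 1 ≤ (n : ℝ) ^ 2 * ℓ := by nlinarith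
    have a2 : 1 ≤ (n : ℝ) ^ 3 * ℓ := by
      have : (1 : ℝ) ≤ n ^ 3 := one_le_pow₀ hN
      nlinarith
    calc _ ≤ (3 * (n ^ 2 * ℓ) + 3 * (27 * (n ^ 2 * ℓ))) * (4 * n + 5 * n)
          + (3 * (n ^ 3 * ℓ) + 3 * (81 * (n ^ 3 * ℓ))) := by
          gcongr <;> linarith
      _ = 1002 * (n ^ 3 * ℓ) := by ring
      _ ≤ _ := by linarith
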